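/- \textbf{Theorem.} Let $k$ be a field, $R=k[x,y,z]$, $\mathfrak m=(x,y,z)$, and let $I\subset R$ be an $\mathfrak m$-primary monomial ideal with minimal monomial generators $m_1,\dots,m_n$, listed in any order. Write $m_{ij}=\operatorname{lcm}(m_i,m_j)$. Call $I$ \emph{generic} if, whenever two distinct minimal generators $m_i,m_j$ have the same positive degree in some variable, there is another minimal generator $m_l$ that strongly divides $m_{ij}$, i.e. $m_l$ divides $m_{ij}/v$ for every variable $v$ dividing $m_{ij}$. For $i<j$ put $\sigma_{ij}=\frac{m_{ij}}{m_j}e_j-\frac{m_{ij}}{m_i}e_i\in R^n$, let $Z_2=\sum_{i<j}R\sigma_{ij}$, and order the $\sigma_{ij}$ by the dictionary order on the index pairs. Let $S_2$ be the set of those $\sigma_{ij}$ such that (1) $\sigma_{ij}\in Z_2\setminus\mathfrak m Z_2$, and (2) $\sigma_{ij}$ cannot be written as $\sum_{p<q}a_{pq}\sigma_{pq}$ with $a_{pq}\in R$ such that $\sigma_{ij}<\sigma_{pq}$ for every pair with $a_{pq}\notin\mathfrak m$. The \emph{maximal ordered resolution} of $R/I$ is the minimal free resolution $$0\to R^{r}\xrightarrow{f_3}R^{S_2}\xrightarrow{f_2}R^n\xrightarrow{f_1}R\to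 R/I\to 0$$ in which $f_1=[m_1\ \cdots\ m_n]$ and the columns of $f_2$ are the elements of $S_2$; thus the columns of the matrix $f_3$ are a basis of $\ker f_2$. If $I$ is not generic, then for every such $f_3$ at least one column of the matrix $f_3$ has more than three nonzero entries. -/

import Mathlib

/-! Monomials of `k[x,y,z]` are given by their exponent vectors `Fin 3 →₀ ℕ`; the variables are
indexed by `Fin 3`.  A list of `n` monomials is a map `d : Fin n → (Fin 3 →₀ ℕ)`; the least common
multiple of two monomials has exponent vector `a ⊔ b`. -/

namespace MonomialRes

open MvPolynomial

/-- The homogeneous maximal ideal `(x, y, z)` of `k[x,y,z]`. -/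
noncomputable def maxIdeal (k : Type*) [Field k] : Ideal (MvPolynomial (Fin 3) k) :=
  Ideal.span (Set.range X)

/-- The monomials with exponent vectors `d 0, …, d (n-1)` are the minimal monomial generators
of the ideal `I`: they generate `I` and none of them divides another one. -/
def IsMinimalGenerators {k : Type*} [Field k] {n : ℕ} (I : Ideal (MvPolynomial (Fin 3) k))
    (d : Fin n → (Fin 3 →₀ ℕ)) : Prop :=
  I = Ideal.span (Set.range fun i => monomial (d i) (1 : k)) ∧ ∀ i j, d i ≤ d j → i = j

/-- `m'` strongly divides `m`: `m'` divides `m / x_s` for every variable `x_s` dividing `m`. -/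
def StronglyDivides (m' m : Fin 3 →₀ ℕ) : Prop :=
  ∀ s : Fin 3, 0 < m s → m' ≤ m - Finsupp.single s 1

/-- Genericity of the monomial ideal with minimal generators `d`: whenever two distinct minimal
generators have the same positive degree in some variable, another minimal generator strongly
divides their least common multiple. -/
def IsGeneric {n : ℕ} (d : Fin n → (Fin 3 →₀ ℕ)) : Prop :=
  ∀ i j : Fin n, i ≠ j → (∃ s : Fin 3, d i s = d j s ∧ 0 < d i s) →
    ∃ l : Fin n, l ≠ i ∧ l ≠ j ∧ StronglyDivides (d l) (d i ⊔ d j)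

/-- The index pairs `(i, j)` with `i < j`. -/
abbrev Pairs (n : ℕ) : Type := {p : Fin n × Fin n // p.1 < p.2}

/-- The dictionary order on index pairs. -/
def pairLT {n : ℕ} (p q : Pairs n) : Prop :=
  p.1.1 < q.1.1 ∨ (p.1.1 = q.1.1 ∧ p.1.2 < q.1.2)

/-- The S-pair `σ_{ij} = (m_{ij} / m_j) e_j - (m_{ij} / m_i) e_i` in `R^n`, `i < j`. -/
noncomputable def sigma (k : Type*) [Field k] {n : ℕ} (d : Fin n → (Fin 3 →₀ ℕ)) (p : Pairs n) :
    Fin n → MvPolynomial (Fin 3) k :=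
  Pi.single p.1.2 (monomial ((d p.1.1 ⊔ d p.1.2) - d p.1.2) 1) -
    Pi.single p.1.1 (monomial ((d p.1.1 ⊔ d p.1.2) - d p.1.1) 1)

/-- The module `Z₂` of second syzygies, generated by all S-pairs. -/
noncomputable def Z2 (k : Type*) [Field k] {n : ℕ} (d : Fin n → (Fin 3 →₀ ℕ)) :
    Submodule (MvPolynomial (Fin 3) k) (Fin n → MvPolynomial (Fin 3) k) :=
  Submodule.span _ (Set.range (sigma k d))

/-- The (indices of the) ordered minimal second syzygies.  In the second condition a coefficient
counts as a unit when it lies outside the homogeneous maximal ideal; for homogeneous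
coefficients this is the same as being a unit of `R`. -/
def S2 (k : Type*) [Field k] {n : ℕ} (d : Fin n → (Fin 3 →₀ ℕ)) : Set (Pairs n) :=
  {p | (sigma k d p ∈ Z2 k d ∧ sigma k d p ∉ maxIdeal k • Z2 k d) ∧
    ¬ ∃ a : Pairs n → MvPolynomial (Fin 3) k,
      sigma k d p = ∑ q, a q • sigma k d q ∧ ∀ q, a q ∉ maxIdeal k → pairLT p q}

noncomputable instance instFintypeS2 (k : Type*) [Field k] {n : ℕ} (d : Fin n → (Fin 3 →₀ ℕ)) :
    Fintype (S2 k d) :=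
  Fintype.ofFinite _

/-- The matrix of `f₂`: its columns are the ordered minimal second syzygies. -/
noncomputable def f2 (k : Type*) [Field k] {n : ℕ} (d : Fin n → (Fin 3 →₀ ℕ)) :
    Matrix (Fin n) (S2 k d) (MvPolynomial (Fin 3) k) :=
  Matrix.of fun v p => sigma k d p.1 v

/-- `f₃` is the matrix of the last map of the maximal ordered resolution: with the matrix `f₂`
above, `0 → R^r → R^{S₂} → R^n` is exact, that is, the columns of `f₃` are a basis of the
kernel of `f₂`. -/
def IsLastMatrix (k : Type*) [Field k] {n r : ℕ} (d : Fin n → (Fin 3 →₀ ℕ))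
    (f₃ : Matrix (S2 k d) (Fin r) (MvPolynomial (Fin 3) k)) : Prop :=
  Function.Injective f₃.mulVecLin ∧ Function.Exact f₃.mulVecLin (f2 k d).mulVecLin

end MonomialRes

/-!
Every S-pair `σ_{ij}` joins two generators, so that `S2` is the edge set of a graph on the generators
of `I`. A nonzero syzygy of `f₂` with at most three nonzero entries is supported on a triangle of this
graph, because each vertex it touches lies on at least two edges of its support
(`exists_triangle`). It is shown that, if every column of `f₃` is of this kind, then `I` is generic.

Let `σ_{ij} ∈ S2` be an edge whose ends have the same degree `a > 0` in a variable `x_s`. Ordered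
minimal second syzygies generate all S-pairs within each multidegree (`sigma_mem_span`). Hence the
graph contains a path from `j` to a pure power of a second variable, from there to a pure power of
the third variable, and from there to `i`, all in `x_s`-degree at most `a`, and each part of the path
misses the multidegree of the edge `ij`. Closing the path by `ij` gives a syzygy of `f₂` whose entry at
`ij` is not divisible by `x_s` (`exists_syzygy_not_dvd`), so some column of `f₃` has this property too.
This column is supported on a triangle `ijl`, and comparing entries shows that the degree of the
generator `l` in `x_s` is at most `a` (`le_of_not_X_dvd`). The maximal `x_s`-degree is then attained
at both `i` and `j`, which forces one of the three edges to have the multidegree of the whole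
triangle (`exists_edge_eq_sup`); the first such edge in the dictionary order is redundant, so it is
not in `S2` (`not_all_mem_S2`), a contradiction. Therefore no edge of `S2` joins two generators of
the same positive degree in a variable (`not_share_of_mem_S2`).

If `I` is not generic, such an edge exists (`exists_mem_S2_share`). Among the pairs that violate
genericity, take those whose least common multiple `γ` has minimal total degree, and among the ones
with the same `γ` the last in the order. By minimality each further generator dividing `γ` forms
with either end of the pair another violating pair with the same `γ`
(`Bad.of_dvd_of_minimal`). Thus every S-pair through `j` that could occur with a unit coefficient in
a relation rewriting `σ_{ij}` is a violating pair, which is not later than `ij`, and `σ_{ij}` lies in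
`S2`.
-/

namespace MonomialRes

open MvPolynomial

variable {k : Type*} [Field k] {n : ℕ} {d : Fin n → (Fin 3 →₀ ℕ)}

/-! ### S-pairs and their multidegrees -/

/-- The exponent vector of `m_{ij}`, which is the multidegree of `σ_{ij}`. -/
noncomputable def lcmDeg (d : Fin n → (Fin 3 →₀ ℕ)) (p : Pairs n) : Fin 3 →₀ ℕ :=
  d p.1.1 ⊔ d p.1.2

/-- The element `x^{δ - d v} e_v` of multidegree `δ`; it is only used when `d v ≤ δ`, so that the
truncated subtraction of exponents is the true one. -/
noncomputable def shifted (k : Type*) [Field k] (d : Fin n → (Fin 3 →₀ ℕ)) (δ : Fin 3 →₀ ℕ)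
    (v : Fin n) : Fin n → MvPolynomial (Fin 3) k :=
  Pi.single v (monomial (δ - d v) 1)

lemma fst_le_lcmDeg (p : Pairs n) : d p.1.1 ≤ lcmDeg d p := le_sup_left

lemma snd_le_lcmDeg (p : Pairs n) : d p.1.2 ≤ lcmDeg d p := le_sup_right

lemma sigma_eq (p : Pairs n) :
    sigma k d p = shifted k d (lcmDeg d p) p.1.2 - shifted k d (lcmDeg d p) p.1.1 := rfl

lemma monomial_smul_shifted {m δ : Fin 3 →₀ ℕ} {v : Fin n} (hv : d v ≤ m) (h : m ≤ δ) (c : k) :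
    monomial (δ - m) c • shifted k d m v = c • shifted k d δ v := by
  unfold shifted
  rw [← Pi.single_smul, ← Pi.single_smul, smul_eq_mul, monomial_mul, tsub_add_tsub_cancel h hv,
    smul_monomial, smul_eq_mul]

lemma monomial_smul_sigma (p : Pairs n) {δ : Fin 3 →₀ ℕ} (h : lcmDeg d p ≤ δ) (c : k) :
    monomial (δ - lcmDeg d p) c • sigma k d p =
      c • (shifted k d δ p.1.2 - shifted k d δ p.1.1) := by
  rw [sigma_eq, smul_sub, monomial_smul_shifted (snd_le_lcmDeg p) h,
    monomial_smul_shifted (fst_le_lcmDeg p) h, smul_sub]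

/-- The projection of `R^n` onto its component of multidegree `δ`, where `e_v` has multidegree
`d v`. -/
noncomputable def homPart (k : Type*) [Field k] (d : Fin n → (Fin 3 →₀ ℕ)) (δ : Fin 3 →₀ ℕ) :
    (Fin n → MvPolynomial (Fin 3) k) →ₗ[k] (Fin n → MvPolynomial (Fin 3) k) where
  toFun f v := coeff (δ - d v) (f v) • if d v ≤ δ then monomial (δ - d v) 1 else 0
  map_add' f g := by ext1 v; by_cases h : d v ≤ δ <;> simp [add_smul, h]
  map_smul' c f := by ext1 v; simp [mul_smul]

lemma homPart_smul_shifted (a : MvPolynomial (Fin 3) k) {m δ : Fin 3 →₀ ℕ} {v : Fin n}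
    (hv : d v ≤ m) : homPart k d δ (a • shifted k d m v) =
      if m ≤ δ then coeff (δ - m) a • shifted k d δ v else 0 := by
  ext1 w
  by_cases hw : w = v
  · subst hw
    by_cases hm : m ≤ δ
    · have h2 : m - d w ≤ δ - d w := tsub_le_tsub_right hm _
      have h3 : δ - d w - (m - d w) = δ - m := tsub_tsub_tsub_cancel_right hv
      simp [homPart, shifted, hm, hv.trans hm, coeff_mul_monomial', h2, h3]
    · have h2 : d w ≤ δ → ¬ m - d w ≤ δ - d w := fun h h' =>
        hm ((tsub_le_tsub_iff_right h).1 h')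
      by_cases h : d w ≤ δ
      · simp [homPart, shifted, hm, h, coeff_mul_monomial', h2 h]
      · simp [homPart, hm, h]
  · have : (if m ≤ δ then coeff (δ - m) a • shifted k d δ v else 0) w = 0 := by
      split_ifs <;> simp [shifted, hw]
    rw [this]
    simp [homPart, shifted, hw]

lemma homPart_smul_sigma (a : MvPolynomial (Fin 3) k) (q : Pairs n) (δ : Fin 3 →₀ ℕ) :
    homPart k d δ (a • sigma k d q) =
      if lcmDeg d q ≤ δ then
        monomial (δ - lcmDeg d q) (coeff (δ - lcmDeg d q) a) • sigma k d q else 0 := by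
  rw [sigma_eq, smul_sub, map_sub, homPart_smul_shifted a (snd_le_lcmDeg q),
    homPart_smul_shifted a (fst_le_lcmDeg q), ← sigma_eq]
  split_ifs with h
  · rw [monomial_smul_sigma q h, smul_sub]
  · simp

/-! ### Ordered minimal second syzygies -/

lemma coeff_zero_of_mem_maxIdeal {a : MvPolynomial (Fin 3) k} (ha : a ∈ maxIdeal k) :
    coeff 0 a = 0 := by
  rw [maxIdeal, ← Set.image_univ, mem_ideal_span_X_image] at ha
  by_contra h
  obtain ⟨i, -, hi⟩ := ha 0 (mem_support_iff.2 h)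
  exact hi rfl

lemma monomial_mem_maxIdeal {m : Fin 3 →₀ ℕ} (hm : m ≠ 0) (c : k) :
    monomial m c ∈ maxIdeal k := by
  rw [maxIdeal, ← Set.image_univ, mem_ideal_span_X_image]
  intro e he
  obtain rfl : e = m := by simpa using (support_monomial_subset he)
  obtain ⟨i, hi⟩ := Finsupp.ne_iff.1 hm
  exact ⟨i, trivial, hi⟩

/-- The minimality condition in the definition of `S2` is a special case of the ordering
condition, with all coefficients in the maximal ideal. -/
lemma notMem_S2_iff (p : Pairs n) : p ∉ S2 k d ↔ ∃ a : Pairs n → MvPolynomial (Fin 3) k,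
    sigma k d p = ∑ q, a q • sigma k d q ∧ ∀ q, a q ∉ maxIdeal k → pairLT p q := by
  constructor
  · intro h
    by_contra hno
    refine h ⟨⟨Submodule.subset_span ⟨p, rfl⟩, fun hm => hno ?_⟩, hno⟩
    rw [Z2, Submodule.mem_ideal_smul_span_iff_exists_sum] at hm
    obtain ⟨a, ha, hs⟩ := hm
    refine ⟨a, ?_, fun q hq => absurd (ha q) hq⟩
    rw [← hs, Finsupp.sum_fintype _ _ (by simp)]
  · exact fun h hp => hp.2 h

lemma pairLT_wellFounded_swap : WellFounded (fun p q : Pairs n => pairLT q p) := by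
  have : IsTrans (Pairs n) (fun p q => pairLT q p) := ⟨fun p q r h1 h2 => by
    unfold pairLT at *; omega⟩
  have : Std.Irrefl (fun p q : Pairs n => pairLT q p) := ⟨fun p h => by
    unfold pairLT at h; omega⟩
  exact Finite.wellFounded_of_trans_of_irrefl _

lemma degree_lt_degree {a b : Fin 3 →₀ ℕ} (h : a ≤ b) (hne : a ≠ b) : a.degree < b.degree := by
  have h0 := h 0
  have h1 := h 1
  have h2 := h 2
  have : ¬ (a 0 = b 0 ∧ a 1 = b 1 ∧ a 2 = b 2) := fun ⟨h0, h1, h2⟩ => hne (by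
    ext s; fin_cases s <;> assumption)
  simp only [Finsupp.degree_eq_sum, Fin.sum_univ_three]
  omega

/-- The ordered minimal second syzygies generate all S-pairs, and this multidegree by multidegree:
an S-pair outside `S2` is rewritten through S-pairs of smaller multidegree or of the same
multidegree and later in the order. -/
lemma sigma_mem_span (q : Pairs n) :
    sigma k d q ∈ Submodule.span (MvPolynomial (Fin 3) k)
      (sigma k d '' {r | r ∈ S2 k d ∧ lcmDeg d r ≤ lcmDeg d q}) := by
  induction hN : (lcmDeg d q).degree using Nat.strong_induction_on generalizing q with
  | _ N ihN =>
  induction q using pairLT_wellFounded_swap.induction with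
  | _ q ihq =>
  by_cases hq : q ∈ S2 k d
  · exact Submodule.subset_span ⟨q, ⟨hq, le_rfl⟩, rfl⟩
  obtain ⟨a, ha, hlt⟩ := (notMem_S2_iff q).1 hq
  have h1 := congrArg (homPart k d (lcmDeg d q)) ha
  have h2 : homPart k d (lcmDeg d q) (sigma k d q) = sigma k d q := by
    have := homPart_smul_sigma (d := d) (1 : MvPolynomial (Fin 3) k) q (lcmDeg d q)
    simpa using this
  rw [h2, map_sum] at h1
  rw [h1]
  refine Submodule.sum_mem _ fun r _ => ?_
  rw [homPart_smul_sigma]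
  split_ifs with hr
  swap
  · exact zero_mem _
  have mono : Submodule.span (MvPolynomial (Fin 3) k)
      (sigma k d '' {t | t ∈ S2 k d ∧ lcmDeg d t ≤ lcmDeg d r}) ≤
      Submodule.span (MvPolynomial (Fin 3) k)
      (sigma k d '' {t | t ∈ S2 k d ∧ lcmDeg d t ≤ lcmDeg d q}) :=
    Submodule.span_mono (Set.image_mono fun t ht => ⟨ht.1, ht.2.trans hr⟩)
  by_cases hrq : lcmDeg d r = lcmDeg d q
  · by_cases h0 : coeff 0 (a r) = 0
    · simp [hrq, h0]
    · refine Submodule.smul_mem _ _ (mono ?_)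
      exact ihq r (hlt r fun hm => h0 (coeff_zero_of_mem_maxIdeal hm)) (by rw [hrq, hN])
  · refine Submodule.smul_mem _ _ (mono ?_)
    exact ihN _ (hN ▸ degree_lt_degree hr hrq) r rfl

/-- Along any two generators `u`, `v`, the difference of the elements of multidegree `δ` over
them is a combination of ordered minimal second syzygies of multidegree dividing `m_{uv}`. -/
lemma shifted_sub_mem_span {δ : Fin 3 →₀ ℕ} {u v : Fin n} (hu : d u ≤ δ) (hv : d v ≤ δ) :
    shifted k d δ v - shifted k d δ u ∈ Submodule.span (MvPolynomial (Fin 3) k)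
      (sigma k d '' {r | r ∈ S2 k d ∧ lcmDeg d r ≤ d u ⊔ d v}) := by
  rcases lt_trichotomy u v with h | rfl | h
  · have h1 := monomial_smul_sigma (k := k) (⟨(u, v), h⟩ : Pairs n) (sup_le hu hv) 1
    rw [one_smul] at h1
    rw [← h1]
    exact Submodule.smul_mem _ _ (sigma_mem_span (⟨(u, v), h⟩ : Pairs n))
  · simp
  · have h1 := monomial_smul_sigma (k := k) (⟨(v, u), h⟩ : Pairs n) (sup_le hv hu) 1
    rw [one_smul] at h1
    rw [← neg_sub, ← h1, sup_comm]
    exact Submodule.neg_mem _ (Submodule.smul_mem _ _ (sigma_mem_span (⟨(v, u), h⟩ : Pairs n)))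

/-- A triangle of ordered minimal second syzygies has none of its edges in the multidegree of the
triangle: the first such edge in the order would be redundant. -/
lemma not_all_mem_S2 {u v w : Fin n} (huv : u < v) (hvw : v < w) {m : Fin 3 →₀ ℕ}
    (hm : m = d u ⊔ d v ⊔ d w)
    (h : d u ⊔ d v = m ∨ d u ⊔ d w = m ∨ d v ⊔ d w = m)
    (h1 : (⟨(u, v), huv⟩ : Pairs n) ∈ S2 k d) (h2 : (⟨(u, w), huv.trans hvw⟩ : Pairs n) ∈ S2 k d)
    (h3 : (⟨(v, w), hvw⟩ : Pairs n) ∈ S2 k d) : False := by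
  set p : Pairs n := ⟨(u, v), huv⟩ with hp
  set q : Pairs n := ⟨(u, w), huv.trans hvw⟩ with hq
  set r : Pairs n := ⟨(v, w), hvw⟩ with hr
  have hpm : lcmDeg d p ≤ m := hm ▸ le_sup_left
  have hqm : lcmDeg d q ≤ m := hm ▸ sup_le_sup_right le_sup_left _
  have hrm : lcmDeg d r ≤ m := hm ▸ sup_le_sup_right le_sup_right _
  have key : monomial (m - lcmDeg d p) (1 : k) • sigma k d p
      + monomial (m - lcmDeg d r) (1 : k) • sigma k d r
      = monomial (m - lcmDeg d q) (1 : k) • sigma k d q := by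
    rw [monomial_smul_sigma p hpm, monomial_smul_sigma q hqm, monomial_smul_sigma r hrm]
    simp [p, q, r]
  have hpq : pairLT p q := Or.inr ⟨rfl, hvw⟩
  have hpr : pairLT p r := Or.inl huv
  have hqr : pairLT q r := Or.inl huv
  have hpq' : p ≠ q := fun h => by simp [p, q] at h; omega
  have hpr' : p ≠ r := fun h => by simp [p, r] at h; omega
  have hqr' : q ≠ r := fun h => by simp [q, r] at h; omega
  -- a linear combination of two S-pairs, written over all pairs
  have redundant : ∀ (x y z : Pairs n) (a b : MvPolynomial (Fin 3) k), y ≠ z →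
      sigma k d x = a • sigma k d y + b • sigma k d z →
      (a ∉ maxIdeal k → pairLT x y) → (b ∉ maxIdeal k → pairLT x z) → x ∉ S2 k d := by
    intro x y z a b hyz hx ha hb
    refine (notMem_S2_iff x).2 ⟨Pi.single y a + Pi.single z b, ?_, ?_⟩
    · simp [add_smul, Finset.sum_add_distrib, Pi.single_apply, ite_smul, hx]
    · intro t ht
      by_cases h1 : t = y
      · subst h1
        exact ha (by simpa [Pi.single_apply, hyz] using ht)
      · by_cases h2 : t = z
        · subst h2
          exact hb (by simpa [Pi.single_apply, h1] using ht)
        · simp [h1, h2] at ht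
  have nonunit : ∀ x : Pairs n, lcmDeg d x ≤ m → lcmDeg d x ≠ m → ∀ c : k,
      monomial (m - lcmDeg d x) c ∈ maxIdeal k := fun x hx hne c =>
    monomial_mem_maxIdeal (fun h => hne (le_antisymm hx (tsub_eq_zero_iff_le.1 h))) c
  by_cases e1 : lcmDeg d p = m
  · refine redundant p q r (monomial (m - lcmDeg d q) 1) (-monomial (m - lcmDeg d r) 1) hqr' ?_
      (fun _ => hpq) (fun _ => hpr) h1
    rw [← key]
    simp [e1]
  by_cases e2 : lcmDeg d q = m
  · refine redundant q p r (monomial (m - lcmDeg d p) 1) (monomial (m - lcmDeg d r) 1) hpr' ?_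
      (fun h => absurd (nonunit p hpm e1 1) h) (fun _ => hqr) h2
    rw [key]
    simp [e2]
  have e3 : lcmDeg d r = m := by
    rcases h with h | h | h
    exacts [absurd h e1, absurd h e2, h]
  refine redundant r q p (monomial (m - lcmDeg d q) 1) (-monomial (m - lcmDeg d p) 1) hpq'.symm ?_
    (fun h => absurd (nonunit q hqm e2 1) h)
    (fun h => absurd (neg_mem (nonunit p hpm e1 1)) h) h3
  rw [← key]
  simp [e3]

/-! ### An edge whose ends have the same positive degree in a variable -/

lemma f2_mulVecLin_apply (c : S2 k d → MvPolynomial (Fin 3) k) (v : Fin n) :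
    (f2 k d).mulVecLin c v = ∑ q : S2 k d, c q * sigma k d q.1 v := by
  simp [f2, Matrix.mulVec, dotProduct, mul_comm]

lemma f2_mulVecLin_single (q : S2 k d) (a : MvPolynomial (Fin 3) k) :
    (f2 k d).mulVecLin (Pi.single q a) = a • sigma k d q.1 := by
  ext1 v
  rw [f2_mulVecLin_apply, Finset.sum_eq_single q] <;> simp +contextual

lemma span_le_map_ker_proj (p : S2 k d) {m : Fin 3 →₀ ℕ} (h : ¬ lcmDeg d p.1 ≤ m) :
    Submodule.span (MvPolynomial (Fin 3) k)
      (sigma k d '' {r | r ∈ S2 k d ∧ lcmDeg d r ≤ m}) ≤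
    (LinearMap.ker (LinearMap.proj p :
      (S2 k d → MvPolynomial (Fin 3) k) →ₗ[MvPolynomial (Fin 3) k] _)).map
        (f2 k d).mulVecLin := by
  rw [Submodule.span_le]
  rintro _ ⟨q, ⟨hq, hqm⟩, rfl⟩
  refine ⟨Pi.single ⟨q, hq⟩ 1, ?_, by rw [f2_mulVecLin_single, one_smul]⟩
  have : p ≠ ⟨q, hq⟩ := fun e => h (by rw [e]; exact hqm)
  simp [this]

/-- Let the generators `i`, `j` have the same positive degree `a` in `x_s`, and let `σ_{ij}` be an
ordered minimal second syzygy. Then some syzygy of `f₂` has a coefficient at `σ_{ij}` that is not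
divisible by `x_s`. It comes from a path from `j` through the pure powers of the two other
variables to `i`, all in `x_s`-degree at most `a`, that avoids the edge `ij`. -/
lemma exists_syzygy_not_dvd (hmin : ∀ i j, d i ≤ d j → i = j)
    (hpow : ∀ t : Fin 3, ∃ v, ∀ t', t' ≠ t → d v t' = 0) (p : S2 k d) (s : Fin 3)
    (hs : d p.1.1.1 s = d p.1.1.2 s) (hpos : 0 < d p.1.1.1 s) :
    ∃ c : S2 k d → MvPolynomial (Fin 3) k, (f2 k d).mulVecLin c = 0 ∧ ¬ X s ∣ c p := by
  set i := p.1.1.1 with hi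
  set j := p.1.1.2 with hj
  have hij : i ≠ j := p.1.2.ne
  obtain ⟨t, ht⟩ : ∃ t, d i t < d j t := by
    by_contra! h
    exact hij (hmin j i h).symm
  obtain ⟨t', ht'⟩ : ∃ t, d j t < d i t := by
    by_contra! h
    exact hij (hmin i j h)
  have hts : s ≠ t := by rintro rfl; omega
  have hts' : s ≠ t' := by rintro rfl; omega
  have htt : t ≠ t' := by rintro rfl; omega
  obtain ⟨v, hv⟩ := hpow t
  obtain ⟨w, hw⟩ := hpow t'
  set δ := d i ⊔ d j ⊔ d v ⊔ d w with hδ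
  have hiδ : d i ≤ δ := le_sup_left.trans (le_sup_left.trans le_sup_left)
  have hjδ : d j ≤ δ := le_sup_right.trans (le_sup_left.trans le_sup_left)
  have hvδ : d v ≤ δ := le_sup_right.trans le_sup_left
  have hwδ : d w ≤ δ := le_sup_right
  -- each step of the path misses the multidegree of `σ_{ij}` in one of the three variables
  have hjv : ¬ lcmDeg d p.1 ≤ d v ⊔ d j := fun h => by
    have h1 := (fst_le_lcmDeg p.1).trans h t'
    simp only [Finsupp.sup_apply, hv t' htt.symm, ← hi] at h1
    omega
  have hiw : ¬ lcmDeg d p.1 ≤ d i ⊔ d w := fun h => by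
    have h1 := (snd_le_lcmDeg p.1).trans h t
    simp only [Finsupp.sup_apply, hw t htt, ← hj] at h1
    omega
  have hvw : ¬ lcmDeg d p.1 ≤ d w ⊔ d v := fun h => by
    have h1 := (fst_le_lcmDeg p.1).trans h s
    simp only [Finsupp.sup_apply, hv s hts, hw s hts', ← hi] at h1
    omega
  have hpδ : lcmDeg d p.1 ≤ δ := sup_le hiδ hjδ
  have hW := add_mem (add_mem
    (span_le_map_ker_proj p hjv (shifted_sub_mem_span (k := k) hvδ hjδ))
    (span_le_map_ker_proj p hvw (shifted_sub_mem_span (k := k) hwδ hvδ)))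
    (span_le_map_ker_proj p hiw (shifted_sub_mem_span (k := k) hiδ hwδ))
  rw [sub_add_sub_cancel, sub_add_sub_cancel] at hW
  obtain ⟨c, hc, hcW⟩ := hW
  have hcp : c p = 0 := hc
  refine ⟨Pi.single p (monomial (δ - lcmDeg d p.1) 1) - c, ?_, ?_⟩
  · rw [map_sub, hcW, f2_mulVecLin_single, monomial_smul_sigma p.1 hpδ, one_smul, sub_self]
  · have hδs : (δ - lcmDeg d p.1) s = 0 := by
      simp only [Finsupp.tsub_apply, hδ, lcmDeg, Finsupp.sup_apply, hv s hts, hw s hts', ← hi, ← hj]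
      omega
    simp [hcp, X_dvd_monomial, hδs]

lemma sigma_ne_zero_iff (q : Pairs n) (v : Fin n) :
    sigma k d q v ≠ 0 ↔ v = q.1.1 ∨ v = q.1.2 := by
  have h := q.2.ne
  by_cases h1 : v = q.1.1
  · subst h1
    simp [sigma, h]
  · by_cases h2 : v = q.1.2
    · subst h2
      simp [sigma, h.symm]
    · simp [sigma, h1, h2]

lemma X_dvd_sigma_iff {q : Pairs n} {v : Fin n} (hv : v = q.1.1 ∨ v = q.1.2) (s : Fin 3) :
    X s ∣ sigma k d q v ↔ d v s < lcmDeg d q s := by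
  have h := q.2.ne
  rcases hv with rfl | rfl
  · simp [sigma, h, X_dvd_monomial, lcmDeg, Nat.sub_eq_zero_iff_le]
  · simp [sigma, h.symm, X_dvd_monomial, lcmDeg, Nat.sub_eq_zero_iff_le]

/-- If a syzygy of `f₂` is nonzero at an edge through `v`, it is nonzero at a second one. -/
lemma exists_other_edge {h : S2 k d → MvPolynomial (Fin 3) k} (hh : (f2 k d).mulVecLin h = 0)
    {p : S2 k d} (hp : h p ≠ 0) {v : Fin n} (hv : v = p.1.1.1 ∨ v = p.1.1.2) :
    ∃ q, q ≠ p ∧ h q ≠ 0 ∧ (v = q.1.1.1 ∨ v = q.1.1.2) := by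
  by_contra! hno
  have h0 := congrFun hh v
  rw [f2_mulVecLin_apply, Finset.sum_eq_single p] at h0
  · exact mul_ne_zero hp ((sigma_ne_zero_iff _ _).2 hv) h0
  · intro q _ hq
    by_cases hq0 : h q = 0
    · simp [hq0]
    · have := hno q hq hq0
      have h1 : sigma k d q.1 v = 0 := by
        by_contra h2
        rcases (sigma_ne_zero_iff _ _).1 h2 with h3 | h3
        exacts [this.1 h3, this.2 h3]
      simp [h1]
  · simp

/-- A syzygy of `f₂` with at most three nonzero entries, one of them at `p`, is supported on a
triangle through `p`: each end of `p` lies on a second edge of the support, and the other ends of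
these two edges coincide, since they too have to lie on at least two edges. -/
lemma exists_triangle {h : S2 k d → MvPolynomial (Fin 3) k} (hh : (f2 k d).mulVecLin h = 0)
    (hcard : {q | h q ≠ 0}.ncard ≤ 3) {p : S2 k d} (hp : h p ≠ 0) :
    ∃ (l : Fin n) (q₁ q₂ : S2 k d), l ≠ p.1.1.1 ∧ l ≠ p.1.1.2 ∧
      (q₁.1.1 = (p.1.1.1, l) ∨ q₁.1.1 = (l, p.1.1.1)) ∧
      (q₂.1.1 = (p.1.1.2, l) ∨ q₂.1.1 = (l, p.1.1.2)) ∧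
      ∀ q, h q ≠ 0 → q = p ∨ q = q₁ ∨ q = q₂ := by
  have ext : ∀ q q' : S2 k d, q.1.1.1 = q'.1.1.1 → q.1.1.2 = q'.1.1.2 → q = q' :=
    fun q q' h1 h2 => Subtype.ext (Subtype.ext (Prod.ext h1 h2))
  have lt : ∀ q : S2 k d, q.1.1.1 < q.1.1.2 := fun q => q.1.2
  obtain ⟨q₁, hq₁, hq₁0, hi⟩ := exists_other_edge hh hp (Or.inl rfl)
  obtain ⟨q₂, hq₂, hq₂0, hj⟩ := exists_other_edge hh hp (Or.inr rfl)
  have hp' := lt p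
  have hq₁' := lt q₁
  have hq₂' := lt q₂
  have h12 : q₁ ≠ q₂ := by
    rintro rfl
    refine hq₁ (ext _ _ ?_ ?_) <;> omega
  have hsub : ({p, q₁, q₂} : Set (S2 k d)) ⊆ {q | h q ≠ 0} := by
    rintro q (rfl | rfl | rfl) <;> assumption
  have hthree : ({p, q₁, q₂} : Set (S2 k d)).ncard = 3 :=
    Set.ncard_eq_three.2 ⟨p, q₁, q₂, hq₁.symm, hq₂.symm, h12, rfl⟩
  have heq := Set.eq_of_subset_of_ncard_le hsub (hcard.trans_eq hthree.symm) (Set.toFinite _)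
  have hsupp : ∀ q, h q ≠ 0 → q = p ∨ q = q₁ ∨ q = q₂ := fun q hq => by
    have : q ∈ ({p, q₁, q₂} : Set (S2 k d)) := heq ▸ hq
    simpa using this
  obtain ⟨l, hl, hql⟩ : ∃ l, l ≠ p.1.1.1 ∧
      (q₁.1.1 = (p.1.1.1, l) ∨ q₁.1.1 = (l, p.1.1.1)) := by
    rcases hi with hi | hi
    · exact ⟨q₁.1.1.2, by omega, Or.inl (by rw [hi])⟩
    · exact ⟨q₁.1.1.1, by omega, Or.inr (by rw [hi])⟩
  have hl2 : l ≠ p.1.1.2 := by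
    rintro rfl
    rcases hql with e | e
    · exact hq₁ (ext _ _ (by rw [e]) (by rw [e]))
    · rw [e] at hq₁'
      exact hp'.not_gt hq₁'
  have hlq : l = q₁.1.1.1 ∨ l = q₁.1.1.2 := by
    rcases hql with e | e <;> rw [e] <;> simp
  obtain ⟨q₃, hq₃, hq₃0, hl3⟩ := exists_other_edge hh hq₁0 hlq
  obtain rfl : q₃ = q₂ := by
    rcases hsupp q₃ hq₃0 with rfl | rfl | rfl
    · omega
    · exact absurd rfl hq₃
    · rfl
  refine ⟨l, q₁, q₃, hl, hl2, hql, ?_, hsupp⟩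
  rcases hj with hj | hj
  · exact Or.inl (Prod.ext hj.symm (by simp only; omega))
  · exact Or.inr (Prod.ext (by simp only; omega) hj.symm)

/-- If a syzygy is supported on a triangle `ijl` and its entry at `ij` is not divisible by `x_s`,
and `i`, `j` have the same degree in `x_s`, then the degree of `l` in `x_s` is not larger. -/
lemma le_of_not_X_dvd {h : S2 k d → MvPolynomial (Fin 3) k} (hh : (f2 k d).mulVecLin h = 0)
    {p q₁ q₂ : S2 k d} {l : Fin n} {s : Fin 3} (hs : d p.1.1.1 s = d p.1.1.2 s)
    (hl : l ≠ p.1.1.2) (hq₁ : q₁.1.1 = (p.1.1.1, l) ∨ q₁.1.1 = (l, p.1.1.1))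
    (hl' : l ≠ p.1.1.1) (hq₂ : q₂.1.1 = (p.1.1.2, l) ∨ q₂.1.1 = (l, p.1.1.2))
    (hsupp : ∀ q, h q ≠ 0 → q = p ∨ q = q₁ ∨ q = q₂) (hX : ¬ X s ∣ h p) :
    d l s ≤ d p.1.1.1 s := by
  by_contra! hlt
  have hpq : p ≠ q₁ := by
    rintro rfl
    rcases hq₁ with e | e
    · exact hl (by rw [e])
    · exact hl' (by rw [e])
  have h0 := congrFun hh p.1.1.1
  rw [f2_mulVecLin_apply, ← Finset.sum_subset (Finset.subset_univ {p, q₁}), Finset.sum_pair hpq,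
    Pi.zero_apply] at h0
  · have h1 : X s ∣ sigma k d q₁.1 p.1.1.1 := by
      rw [X_dvd_sigma_iff (by rcases hq₁ with e | e <;> simp [e])]
      rcases hq₁ with e | e <;> simp [lcmDeg, e, hlt]
    have h2 : X s ∣ h p * sigma k d p.1 p.1.1.1 := by
      rw [eq_neg_of_add_eq_zero_left h0]
      exact (dvd_mul_of_dvd_right h1 _).neg_right
    rcases X_prime.dvd_or_dvd h2 with h3 | h3
    · exact hX h3
    · rw [X_dvd_sigma_iff (Or.inl rfl)] at h3
      simp [lcmDeg, hs] at h3
  · intro q _ hq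
    by_cases hq0 : h q = 0
    · simp [hq0]
    have hq2 : q = q₂ := by
      rcases hsupp q hq0 with rfl | rfl | rfl
      · simp at hq
      · simp at hq
      · rfl
    subst hq2
    have hp' : p.1.1.1 ≠ p.1.1.2 := p.1.2.ne
    have : sigma k d q.1 p.1.1.1 = 0 := by
      by_contra h2
      rcases (sigma_ne_zero_iff _ _).1 h2 with h3 | h3 <;> rcases hq₂ with e | e <;>
        rw [e] at h3
      exacts [hp' h3, hl' h3.symm, hl' h3.symm, hp' h3]
    simp [this]

/-- In a triangle `ijl` whose vertices `i`, `j` both attain the maximal degree in `x_s`, at least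
one edge has the multidegree of the triangle: otherwise each of the three vertices would be the
only one to attain the maximum in some variable, and these would be variables other than `x_s`. -/
lemma exists_edge_eq_sup {a b c : Fin 3 →₀ ℕ} {s : Fin 3} (hab : a s = b s) (hc : c s ≤ a s) :
    a ⊔ b = a ⊔ b ⊔ c ∨ a ⊔ c = a ⊔ b ⊔ c ∨ b ⊔ c = a ⊔ b ⊔ c := by
  by_contra! h
  obtain ⟨h1, h2, h3⟩ := h
  obtain ⟨t1, h1⟩ := Finsupp.ne_iff.1 h1
  obtain ⟨t2, h2⟩ := Finsupp.ne_iff.1 h2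
  obtain ⟨t3, h3⟩ := Finsupp.ne_iff.1 h3
  simp only [Finsupp.sup_apply] at h1 h2 h3
  have e1 : t1 ≠ s := by rintro rfl; omega
  have e2 : t2 ≠ s := by rintro rfl; omega
  have e3 : t3 ≠ s := by rintro rfl; omega
  have e4 : t1 ≠ t2 := by rintro rfl; omega
  have e5 : t1 ≠ t3 := by rintro rfl; omega
  have e6 : t2 ≠ t3 := by rintro rfl; omega
  omega

/-- If no column of `f₃` has more than three nonzero entries, the ends of an ordered minimal
second syzygy never have the same positive degree in a variable. -/
lemma not_share_of_mem_S2 (hmin : ∀ i j, d i ≤ d j → i = j)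
    (hpow : ∀ t : Fin 3, ∃ v, ∀ t', t' ≠ t → d v t' = 0) {r : ℕ}
    {f₃ : Matrix (S2 k d) (Fin r) (MvPolynomial (Fin 3) k)} (hf₃ : IsLastMatrix k d f₃)
    (hcard : ∀ c : Fin r, {q : S2 k d | f₃ q c ≠ 0}.ncard ≤ 3) (p : S2 k d) (s : Fin 3)
    (hs : d p.1.1.1 s = d p.1.1.2 s) (hpos : 0 < d p.1.1.1 s) : False := by
  obtain ⟨c, hc, hcp⟩ := exists_syzygy_not_dvd hmin hpow p s hs hpos
  obtain ⟨g, rfl⟩ := (hf₃.2 c).1 hc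
  obtain ⟨t, ht⟩ : ∃ t, ¬ X s ∣ f₃ p t := by
    by_contra! h
    refine hcp ?_
    rw [Matrix.mulVecLin_apply, Matrix.mulVec, dotProduct]
    exact Finset.dvd_sum fun t _ => Dvd.dvd.mul_right (h t) _
  have hcol : (f2 k d).mulVecLin (fun q => f₃ q t) = 0 := by
    refine (hf₃.2 _).2 ⟨Pi.single t 1, ?_⟩
    rw [Matrix.mulVecLin_apply, Matrix.mulVec_single_one]
    rfl
  have hpt : f₃ p t ≠ 0 := fun h => ht (h ▸ dvd_zero _)
  obtain ⟨l, q₁, q₂, hl, hl2, hq₁, hq₂, hsupp⟩ := exists_triangle hcol (hcard t) hpt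
  have hls := le_of_not_X_dvd hcol hs hl2 hq₁ hl hq₂ hsupp ht
  have hsup := exists_edge_eq_sup hs hls
  obtain ⟨⟨⟨i, j⟩, hij⟩, hp⟩ := p
  obtain ⟨⟨⟨i₁, l₁⟩, h₁⟩, hq₁S⟩ := q₁
  obtain ⟨⟨⟨j₂, l₂⟩, h₂⟩, hq₂S⟩ := q₂
  simp only [Prod.mk.injEq] at hq₁ hq₂ hsup h₁ h₂ hij hl hl2
  rcases hq₁ with ⟨rfl, rfl⟩ | ⟨rfl, rfl⟩ <;> rcases hq₂ with ⟨rfl, rfl⟩ | ⟨rfl, rfl⟩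
  · exact not_all_mem_S2 hij h₂ rfl hsup hp hq₁S hq₂S
  · refine not_all_mem_S2 h₁ h₂ rfl ?_ hq₁S hp hq₂S
    simp only [sup_comm, sup_left_comm] at hsup ⊢
    tauto
  · exact absurd (h₁.trans hij) h₂.not_gt
  · refine not_all_mem_S2 h₁ hij rfl ?_ hq₁S hq₂S hp
    simp only [sup_comm, sup_left_comm] at hsup ⊢
    tauto

/-! ### Non-generic ideals -/

/-- Two generators obstruct genericity: they have the same positive degree in some variable and
no generator strongly divides their least common multiple. -/
def Bad (d : Fin n → (Fin 3 →₀ ℕ)) (i j : Fin n) : Prop :=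
  (∃ s, d i s = d j s ∧ 0 < d i s) ∧ ∀ l, ¬ StronglyDivides (d l) (d i ⊔ d j)

lemma Bad.symm {i j : Fin n} (h : Bad d i j) : Bad d j i := by
  obtain ⟨⟨s, h1, h2⟩, h3⟩ := h
  exact ⟨⟨s, h1.symm, h1 ▸ h2⟩, by rwa [sup_comm]⟩

lemma stronglyDivides_iff {a m : Fin 3 →₀ ℕ} (hm : m ≠ 0) :
    StronglyDivides a m ↔ a ≤ m ∧ ∀ s, 0 < m s → a s < m s := by
  constructor
  · intro h
    obtain ⟨s, hs⟩ := Finsupp.ne_iff.1 hm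
    refine ⟨(h s (Nat.pos_of_ne_zero hs)).trans tsub_le_self, fun t ht => ?_⟩
    have := h t ht t
    simp at this
    omega
  · rintro ⟨h1, h2⟩ s hs t
    have h3 := h1 t
    have h4 := h2 s hs
    by_cases e : s = t
    · subst e
      simp
      omega
    · simpa [Finsupp.single_apply, e] using h3

lemma sup_ne_zero_of_share {a b : Fin 3 →₀ ℕ} {s : Fin 3} (h : 0 < a s) : a ⊔ b ≠ 0 := by
  intro e
  have : (a ⊔ b) s = 0 := by rw [e]; rfl
  simp at this
  omega

/-- A pair with a common positive degree whose least common multiple divides the one of a bad pair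
is bad itself. -/
lemma Bad.of_le {i j u v : Fin n} (h : Bad d i j) {s : Fin 3} (hs : d u s = d v s)
    (hpos : 0 < d u s) (hle : d u ⊔ d v ≤ d i ⊔ d j) : Bad d u v := by
  refine ⟨⟨s, hs, hpos⟩, fun l hl => h.2 l ?_⟩
  obtain ⟨⟨t, -, ht⟩, -⟩ := h
  rw [stronglyDivides_iff (sup_ne_zero_of_share ht)]
  rw [stronglyDivides_iff (sup_ne_zero_of_share hpos)] at hl
  refine ⟨hl.1.trans hle, fun r hr => ?_⟩
  have h1 := hle r
  rcases Nat.eq_zero_or_pos ((d u ⊔ d v) r) with h0 | h0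
  · have := hl.1 r
    omega
  · exact (hl.2 r h0).trans_le h1

lemma exists_bad (hgen : ¬ IsGeneric d) : ∃ i j : Fin n, i < j ∧ Bad d i j := by
  unfold IsGeneric at hgen
  push Not at hgen
  obtain ⟨i, j, hij, ⟨s, hs, hpos⟩, hno⟩ := hgen
  have hbad : Bad d i j := by
    refine ⟨⟨s, hs, hpos⟩, fun l hl => ?_⟩
    -- a strong divisor has smaller `x_s`-degree than `i` and `j`, hence differs from both
    have h1 := ((stronglyDivides_iff (sup_ne_zero_of_share hpos)).1 hl).2 s (by simp [hpos])
    simp only [Finsupp.sup_apply] at h1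
    refine hno l ?_ ?_ hl <;> rintro rfl <;> omega
  rcases lt_or_gt_of_ne hij with h | h
  exacts [⟨i, j, h, hbad⟩, ⟨j, i, h, hbad.symm⟩]

/-- For a bad pair `ij` of minimal multidegree, every other generator dividing `m_{ij}` forms with
`j` a bad pair of the same multidegree. -/
lemma Bad.of_dvd_of_minimal (hmin : ∀ i j, d i ≤ d j → i = j) {i j w : Fin n} (hij : i ≠ j)
    (h : Bad d i j)
    (hsmall : ∀ u v, u ≠ v → Bad d u v → d u ⊔ d v ≤ d i ⊔ d j → d u ⊔ d v = d i ⊔ d j)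
    (hw : d w ≤ d i ⊔ d j) (hwj : w ≠ j) : Bad d w j ∧ d w ⊔ d j = d i ⊔ d j := by
  have hwj' : d w ⊔ d j ≤ d i ⊔ d j := sup_le hw le_sup_right
  have hwi' : d w ⊔ d i ≤ d i ⊔ d j := sup_le hw le_sup_left
  suffices hshare : ∃ t, d w t = d j t ∧ 0 < d w t by
    obtain ⟨t, ht, hpos⟩ := hshare
    have hb : Bad d w j := h.of_le ht hpos hwj'
    exact ⟨hb, hsmall w j hwj hb hwj'⟩
  by_cases hwi : w = i
  · subst hwi
    exact h.1
  by_contra hno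
  push Not at hno
  obtain ⟨⟨s, hs, hpos⟩, hstrong⟩ := id h
  have hw' := hstrong w
  rw [stronglyDivides_iff (sup_ne_zero_of_share hpos)] at hw'
  push Not at hw'
  -- `w` attains the maximum in some variable `t`, which must then be attained by `i` only
  obtain ⟨t, ht0, ht⟩ := hw' hw
  have ht' := hw t
  have hnt := hno t
  simp only [Finsupp.sup_apply] at ht0 ht ht'
  have hti : d w t = d i t := by omega
  have htj : d j t < d i t := by omega
  -- so `iw` is bad of the same multidegree, and `w` attains the maximum wherever `j` alone does
  have hb : Bad d w i := h.of_le hti (by omega) hwi'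
  have heq := hsmall w i hwi hb hwi'
  obtain ⟨t', hlt⟩ : ∃ t, d i t < d j t := by
    by_contra! hle
    exact hij (hmin j i hle).symm
  have h1 := DFunLike.congr_fun heq t'
  simp only [Finsupp.sup_apply] at h1
  have := hno t' (by omega)
  omega

/-- For a non-generic ideal some ordered minimal second syzygy has ends with the same positive
degree in a variable: take the last one among the bad pairs of a minimal multidegree. -/
lemma exists_mem_S2_share (k : Type*) [Field k] (hmin : ∀ i j, d i ≤ d j → i = j)
    (hgen : ¬ IsGeneric d) :
    ∃ p : S2 k d, ∃ s, d p.1.1.1 s = d p.1.1.2 s ∧ 0 < d p.1.1.1 s := by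
  obtain ⟨i₀, j₀, hij₀, hbad₀⟩ := exists_bad hgen
  obtain ⟨p₀, hp₀, hp₀min⟩ := Set.exists_min_image {p : Pairs n | Bad d p.1.1 p.1.2}
    (fun p => (lcmDeg d p).degree) (Set.toFinite _) ⟨⟨(i₀, j₀), hij₀⟩, hbad₀⟩
  obtain ⟨p, ⟨hp, hpp₀⟩, hpmax⟩ := pairLT_wellFounded_swap.has_min
    {p : Pairs n | Bad d p.1.1 p.1.2 ∧ lcmDeg d p = lcmDeg d p₀} ⟨p₀, hp₀, rfl⟩
  have hsmall : ∀ u v, u ≠ v → Bad d u v → d u ⊔ d v ≤ d p.1.1 ⊔ d p.1.2 →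
      d u ⊔ d v = d p.1.1 ⊔ d p.1.2 := by
    intro u v huv hbad hle
    by_contra hne
    have hlt := degree_lt_degree hle hne
    change _ < (lcmDeg d p).degree at hlt
    rw [hpp₀] at hlt
    rcases lt_or_gt_of_ne huv with h | h
    · exact hlt.not_ge (hp₀min ⟨(u, v), h⟩ hbad)
    · exact hlt.not_ge (by simpa [lcmDeg, sup_comm] using hp₀min ⟨(v, u), h⟩ hbad.symm)
  suffices hS : p ∈ S2 k d by exact ⟨⟨p, hS⟩, hp.1⟩
  by_contra hS
  obtain ⟨a, ha, hlt⟩ := (notMem_S2_iff p).1 hS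
  -- in the part of multidegree `m_{ij}`, some coefficient at an edge through `j` is nonzero
  have h1 := congrFun (congrArg (homPart k d (lcmDeg d p)) ha) p.1.2
  have h2 : homPart k d (lcmDeg d p) (sigma k d p) = sigma k d p := by
    have := homPart_smul_sigma (d := d) (1 : MvPolynomial (Fin 3) k) p (lcmDeg d p)
    simpa using this
  rw [h2, map_sum, Finset.sum_apply] at h1
  obtain ⟨q, -, hq⟩ := Finset.exists_ne_zero_of_sum_ne_zero
    (h1 ▸ (sigma_ne_zero_iff (k := k) (d := d) p p.1.2).2 (Or.inr rfl))
  rw [homPart_smul_sigma] at hq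
  split_ifs at hq with hqp
  swap
  · exact hq rfl
  rw [Pi.smul_apply, smul_eq_mul] at hq
  have hqj := (sigma_ne_zero_iff _ _).1 (right_ne_zero_of_mul hq)
  have hqne : q.1.1 ≠ q.1.2 := q.2.ne
  have hqS : Bad d q.1.1 q.1.2 ∧ lcmDeg d q = lcmDeg d p := by
    rcases hqj with e | e
    · have := hp.of_dvd_of_minimal hmin p.2.ne hsmall ((snd_le_lcmDeg q).trans hqp)
        (e ▸ hqne.symm)
      rw [e] at this
      exact ⟨this.1.symm, by rw [lcmDeg, sup_comm, this.2, lcmDeg, e]⟩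
    · have := hp.of_dvd_of_minimal hmin p.2.ne hsmall ((fst_le_lcmDeg q).trans hqp)
        (e ▸ hqne)
      rw [e] at this
      exact ⟨this.1, by rw [lcmDeg, this.2, lcmDeg, e]⟩
  refine hpmax q ⟨hqS.1, hqS.2.trans hpp₀⟩ (hlt q fun hm => left_ne_zero_of_mul hq ?_)
  rw [hqS.2, tsub_self, coeff_zero_of_mem_maxIdeal hm, monomial_zero]

/-- An `𝔪`-primary monomial ideal has a power of each variable among its generators. -/
lemma exists_pure_power {I : Ideal (MvPolynomial (Fin 3) k)} (hrad : I.radical = maxIdeal k)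
    (hd : IsMinimalGenerators I d) (t : Fin 3) : ∃ v, ∀ t', t' ≠ t → d v t' = 0 := by
  have hX : (X t : MvPolynomial (Fin 3) k) ∈ I.radical := by
    rw [hrad]
    exact Ideal.subset_span ⟨t, rfl⟩
  obtain ⟨N, hN⟩ := hX
  have hI : I = Ideal.span ((fun s => monomial s (1 : k)) '' Set.range d) := by
    rw [hd.1, ← Set.range_comp]
    rfl
  rw [hI, mem_ideal_span_monomial_image] at hN
  obtain ⟨_, ⟨v, rfl⟩, hv⟩ := hN (Finsupp.single t N) (by simp [X_pow_eq_monomial])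
  refine ⟨v, fun t' ht' => ?_⟩
  simpa [Finsupp.single_apply, ht'.symm] using hv t'

end MonomialRes

theorem mainTheorem2 (k : Type*) [Field k] (I : Ideal (MvPolynomial (Fin 3) k))
    (hprim : I.IsPrimary) (hrad : I.radical = MonomialRes.maxIdeal k)
    (n : ℕ) (d : Fin n → (Fin 3 →₀ ℕ)) (hd : MonomialRes.IsMinimalGenerators I d)
    (hgen : ¬ MonomialRes.IsGeneric d)
    (r : ℕ) (f₃ : Matrix (MonomialRes.S2 k d) (Fin r) (MvPolynomial (Fin 3) k))
    (hf₃ : MonomialRes.IsLastMatrix k d f₃) :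
    ∃ c : Fin r, 3 < {p : MonomialRes.S2 k d | f₃ p c ≠ 0}.ncard := by
  by_contra! hcard
  obtain ⟨p, s, hs, hpos⟩ := MonomialRes.exists_mem_S2_share k hd.2 hgen
  exact MonomialRes.not_share_of_mem_S2 hd.2 (MonomialRes.exists_pure_power hrad hd) hf₃ hcard
    p s hs hpos
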